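/- \textbf{Formulas.} Fix a set of propositional letters $p$ and a set of variables $x$. Formulas are $\varphi ::= p \mid \neg p \mid x \mid \varphi\wedge\varphi \mid \varphi\vee\varphi \mid \Box\varphi \mid \Diamond\varphi \mid \mu x.\varphi \mid \nu x.\varphi$. Write $x<_\varphi y$ if $\varphi$ has a subformula $\sigma y.\psi$ ($\sigma\in\{\mu,\nu\}$) in which $x$ is free; $\varphi$ is \emph{well-named} if $<_\varphi$ is a strict preorder. $V_\nu(\varphi)$ is the set of variables bound by a $\nu$ in $\varphi$. $\varphi[\psi/x]$ replaces all instances of $x$ by $\psi$ and is defined only if $x$ is not bound in $\varphi$. \textbf{Preproofs.} For a set of sequents and rules, a preproof is a finite tree labelled with sequents, with a partial map $\beta$ from leaves (buds) to inner nodes (companions) such that $\beta(t)$ is a proper prefix of $t$ and carries the same sequent as $t$; every node that is not a bud is the conclusion of a rule instance whose premises label its children, or is an open leaf. Proofs have no open leaves. \textbf{$\mathrm{K}_\mu$.} Sequents are finite sets $\Gamma$ of well-named formulas; commas denote union (so the context may contain the principal formula). Rules (premises / conclusion): Ax: $/\,p,\neg p$; Wk: $\Gamma\,/\,\Gamma,\varphi$;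 $\vee$: $\Gamma,\varphi,\psi\,/\,\Gamma,\varphi\vee\psi$; $\wedge$: $\Gamma,\varphi$ and $\Gamma,\psi\,/\,\Gamma,\varphi\wedge\psi$; Mod: $\Gamma,\varphi\,/\,\Diamond\Gamma,\Box\varphi$; $\sigma\in\{\mu,\nu\}$: $\Gamma,\varphi[\sigma x.\varphi/x]\,/\,\Gamma,\sigma x.\varphi$. A formula of a premise is a precursor of a formula of the conclusion if both are the same context formula, or the former results from the latter as principal formula (in Mod all formulas are principal). Let $\mathbb F=\{0,1,2\}$ with join $\max$ and activation element $1$. A sequent $\Gamma$ is assigned the finite set $\{(\varphi,x):\varphi\in\Gamma,\ x\in V_\nu(\varphi)\}$; a step from the conclusion to a premise is assigned the relation of all $((\varphi,x),a,(\varphi',x))$ with $\varphi'$ a precursor of $\varphi$, where $a=2$ if the rule is $\mu$, $\varphi=\mu y.\theta$, $\varphi'=\theta[\mu y.\theta/y]$ and $y<_\varphi x$; $a=1$ if the rule is $\nu$, $\varphi=\nu x.\theta$ and $\varphi'=\theta[\nu x.\theta/x]$; $a=0$ otherwise. Steps from buds to companions are identities (labelled $0$); relations compose by taking the join of the labels.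 A $\mathrm{K}_\mu$-proof is a preproof without open leaves such that every infinite branch $\pi$ from the root has indices $i_0<i_1<\cdots$ and pairs $s_n$ over the sequents at $\pi_{i_n}$ such that $(s_n,1,s_{n+1})$ lies in the composite relation from $\pi_{i_n}$ to $\pi_{i_{n+1}}$, for all $n$. Write $\mathrm{K}_\mu\vdash\Gamma$ if some $\mathrm{K}_\mu$-proof has root label $\Gamma$. \textbf{$\mathrm{RK}_\mu^{\mathbb F}$.} Fix a set of letters. Sequents are $\Theta\mid\Gamma$, where the control $\Theta$ is a finite sequence of distinct letters and $\Gamma$ is a finite set of pairs $(\varphi,\sigma)$ with $\varphi$ well-named and $\sigma$ a map from $V_\nu(\varphi)$ to subsequences of $\Theta$. $\varepsilon$ denotes the empty sequence and the annotation constantly $\varepsilon$. In a premise, $\Theta'$ is $\Theta$ without the letters that occur in no annotation of that premise, and $\sigma'$ is $\sigma$ restricted to the $\nu$-bound variables of the formula it annotates. Rules: Ax: $/\,\Theta\mid(p,\varepsilon),(\neg p,\varepsilon)$; Wk: $\Theta'\mid\Gamma\ /\ \Theta\mid\Gamma,(\varphi,\sigma)$; $\vee$: $\Theta\mid\Gamma,(\varphi,\sigma'),(\psi,\sigma')\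 /\ \Theta\mid\Gamma,(\varphi\vee\psi,\sigma)$; $\wedge$: $\Theta'\mid\Gamma,(\varphi,\sigma')$ and $\Theta'\mid\Gamma,(\psi,\sigma')\ /\ \Theta\mid\Gamma,(\varphi\wedge\psi,\sigma)$; Mod: $\Theta\mid\Gamma,(\varphi,\sigma)\ /\ \Theta\mid\Diamond\Gamma,(\Box\varphi,\sigma)$, where $\Diamond\Gamma=\{(\Diamond\psi,\tau):(\psi,\tau)\in\Gamma\}$; $\mu$: $\Theta'\mid\Gamma,(\varphi[\mu x.\varphi/x],\sigma\setminus x)\ /\ \Theta\mid\Gamma,(\mu x.\varphi,\sigma)$, where $(\sigma\setminus x)(y)=\varepsilon$ if $x<_{\mu x.\varphi}y$ and $\sigma(y)$ otherwise; $\nu$: $\Theta a\mid\Gamma,(\varphi[\nu x.\varphi/x],\tau')\ /\ \Theta\mid\Gamma,(\nu x.\varphi,\sigma)$ with $a\notin\Theta$, where $\tau$ agrees with $\sigma$ except that $\tau(x)=\sigma(x)a$; $\mathrm{Reset}_a$: $\Theta'\mid\Gamma{\restriction}a\ /\ \Theta\mid\Gamma$, if $a\in\Theta$ is covered, i.e.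 never the last letter of a sequence assigned in $\Gamma$, where ${\restriction}a$ replaces each assigned sequence $uav$ by $ua$ and leaves sequences without $a$ unchanged; Merge: $\Theta'\mid\Gamma,(\varphi,\rho)\ /\ \Theta\mid\Gamma,(\varphi,\sigma),(\varphi,\tau)$, where $\rho(x)$ is the $<_\Theta$-minimum of $\sigma(x)$ and $\tau(x)$, and $u<_\Theta v$ iff $u$ contains the $\Theta$-least letter that occurs in exactly one of $u,v$. An $\mathrm{RK}_\mu^{\mathbb F}$-proof is a preproof without open leaves such that for every bud $t$ there is a letter $a$ which occurs in all controls on the path from $\beta(t)$ to $t$, always with the same prefix before it, such that $\mathrm{Reset}_a$ is applied on this path. For a finite set $\Gamma$ of well-named formulas, $\mathrm{RK}_\mu^{\mathbb F}\vdash\Gamma$ means that some such proof has root label $\varepsilon\mid\{(\varphi,\varepsilon):\varphi\in\Gamma\}$. \textbf{Soundness.} If an annotated sequent $\Theta\mid\Gamma$ is the root label of an $\mathrm{RK}_\mu^{\mathbb F}$-proof, then $\mathrm{K}_\mu\vdash\overline\Gamma$, where $\overline\Gamma=\{\varphi : (\varphi,\sigma)\in\Gamma\}$. In particular, if $\mathrm{RK}_\mu^{\mathbb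 F}\vdash\Gamma$ for a finite set $\Gamma$ of well-named formulas, then $\mathrm{K}_\mu\vdash\Gamma$. -/

import Mathlib

open CategoryTheory

namespace CyclicMu

universe u v w z

/-! ### Cyclic proof systems -/

/-- A derivation system: sequents, rules, and for each rule its conclusion and list of premises. -/
structure DerivationSystem where
  Seq : Type u
  Rule : Type v
  concl : Rule → Seq
  prems : Rule → List Seq

/-- A finite tree: a finite, nonempty, prefix-closed set of words over `ℕ`. -/
structure FinTree where
  nodes : Set (List ℕ)
  finite : nodes.Finite
  nil_mem : [] ∈ nodes
  prefix_mem : ∀ s t, t ∈ nodes → s <+: t → s ∈ nodes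

/-- The children of a node. -/
def FinTree.children (T : FinTree) (t : List ℕ) : Set (List ℕ) :=
  {s | s ∈ T.nodes ∧ ∃ i : ℕ, s = t ++ [i]}

def FinTree.IsLeaf (T : FinTree) (t : List ℕ) : Prop :=
  t ∈ T.nodes ∧ T.children t = ∅

def FinTree.IsInner (T : FinTree) (t : List ℕ) : Prop :=
  t ∈ T.nodes ∧ (T.children t).Nonempty

/-- A cyclic tree: a finite tree with a partial function `back` from leaves (the buds) to inner
nodes (their companions) that are strictly smaller in the prefix order. -/
structure CyclicTree extends FinTree where
  back : List ℕ → Option (List ℕ)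
  back_leaf : ∀ t c, back t = some c → toFinTree.IsLeaf t
  back_inner : ∀ t c, back t = some c → toFinTree.IsInner c
  back_lt : ∀ t c, back t = some c → c <+: t ∧ c ≠ t

/-- Preproofs.  The label function is total on words; its values outside the tree are irrelevant.
The premises of a rule are numbered from `0`. -/
structure Preproof (D : DerivationSystem.{u, v}) extends CyclicTree where
  lab : List ℕ → D.Seq
  lab_back : ∀ t c, back t = some c → lab t = lab c
  rule : List ℕ → Option D.Rule
  rule_mem : ∀ t r, rule t = some r → t ∈ nodes
  rule_not_bud : ∀ t r, rule t = some r → back t = none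
  rule_concl : ∀ t r, rule t = some r → D.concl r = lab t
  rule_children : ∀ t r, rule t = some r →
    toFinTree.children t = {s | ∃ i : ℕ, i < (D.prems r).length ∧ s = t ++ [i]}
  rule_prems : ∀ t r, rule t = some r → ∀ (i : ℕ) (Δ : D.Seq),
    (D.prems r)[i]? = some Δ → lab (t ++ [i]) = Δ
  leaf_of_no_rule : ∀ t, t ∈ nodes → back t = none → rule t = none → toFinTree.IsLeaf t

namespace Preproof

variable {D : DerivationSystem.{u, v}}

/-- The sequent at the root. -/
def endseq (Q : Preproof D) : D.Seq := Q.lab []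

/-- Open leaves: leaves that are neither buds nor conclusions of rules. -/
def IsOpen (Q : Preproof D) (t : List ℕ) : Prop :=
  Q.IsLeaf t ∧ Q.back t = none ∧ Q.rule t = none

/-- The preproof has no assumptions. -/
def NoAssumptions (Q : Preproof D) : Prop := ∀ t, ¬ Q.IsOpen t

/-- Infinite branches through the cyclic tree. -/
structure IsBranch (Q : Preproof D) (b : ℕ → List ℕ) : Prop where
  zero : b 0 = []
  inner : ∀ i, ¬ Q.IsLeaf (b i) → b (i + 1) ∈ Q.children (b i)
  leaf : ∀ i, Q.IsLeaf (b i) → Q.back (b i) = some (b (i + 1))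

end Preproof

/-- A cyclic proof system: a derivation system with a distinguished set of preproofs without
assumptions, its proofs. -/
structure CyclicProofSystem extends DerivationSystem.{u, v} where
  proofs : Set (Preproof toDerivationSystem)
  no_assumptions : ∀ Q ∈ proofs, Q.NoAssumptions

/-- `Γ` is the endsequent of some proof. -/
def CyclicProofSystem.Proves (R : CyclicProofSystem.{u, v}) (Γ : R.Seq) : Prop :=
  ∃ Q ∈ R.proofs, Q.endseq = Γ

/-! ### Activation algebras, trace categories, global trace conditions -/

/-- An activation algebra: a finite join-semilattice with least element and a fixed activation
element different from the least element. -/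
class ActivationAlgebra (A : Type w) [SemilatticeSup A] [OrderBot A] [Finite A] where
  act : A
  act_ne_bot : act ≠ ⊥

/-- The failure algebra `{0, 1, 2}` with `max` as join and activation element `1`. -/
instance failureAlgebra : ActivationAlgebra (Fin 3) where
  act := 1
  act_ne_bot := by decide

/-- Objects of the `A`-activated trace category: finite sets. -/
structure TraceCat (A : Type w) where
  carrier : Type z
  finite : Finite carrier

namespace TraceCat

variable {A : Type w} [SemilatticeSup A] [OrderBot A]

/-- Morphisms from `X` to `Y` are the subsets of `X × A × Y`. -/
instance : Category (TraceCat.{w, z} A) where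
  Hom X Y := Set (X.carrier × A × Y.carrier)
  id X := {t | t.1 = t.2.2 ∧ t.2.1 = ⊥}
  comp {X Y Z} R R' := {t | ∃ (y : Y.carrier) (a b : A),
    (t.1, a, y) ∈ (R : Set (X.carrier × A × Y.carrier)) ∧
    (y, b, t.2.2) ∈ (R' : Set (Y.carrier × A × Z.carrier)) ∧ a ⊔ b = t.2.1}
  id_comp {X Y} f := by
    ext ⟨x, c, y⟩
    constructor
    · rintro ⟨x', a, b, ⟨h1, h2⟩, h3, h4⟩
      simp only at h1 h2 h3 h4
      subst h1 h2 h4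
      simpa using h3
    · intro h
      exact ⟨x, ⊥, c, ⟨rfl, rfl⟩, h, by simp⟩
  comp_id {X Y} f := by
    ext ⟨x, c, y⟩
    constructor
    · rintro ⟨y', a, b, h3, ⟨h1, h2⟩, h4⟩
      simp only at h1 h2 h3 h4
      subst h1 h2 h4
      simpa using h3
    · intro h
      exact ⟨y, c, ⊥, h, ⟨rfl, rfl⟩, by simp⟩
  assoc {W X Y Z} f g h := by
    ext ⟨x, c, y⟩
    constructor
    · rintro ⟨y1, a, b, ⟨y2, a', b', h1, h2, h3⟩, h4, h5⟩
      simp only at h1 h2 h3 h4 h5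
      exact ⟨y2, a', b' ⊔ b, h1, ⟨y1, b', b, h2, h4, rfl⟩, by rw [← h5, ← h3, sup_assoc]⟩
    · rintro ⟨y1, a, b, h1, ⟨y2, a', b', h2, h3, h4⟩, h5⟩
      simp only at h1 h2 h3 h4 h5
      exact ⟨y2, a ⊔ a', b', ⟨y1, a, a', h1, h2, rfl⟩, h3, by rw [← h5, ← h4, sup_assoc]⟩

/-- The set of triples underlying a morphism. -/
def rel {X Y : TraceCat.{w, z} A} (f : X ⟶ Y) : Set (X.carrier × A × Y.carrier) := f

/-- The trace condition on paths: some subpath (precomposition with a strictly monotone map)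
carries an infinite sequence all of whose steps are labelled with the activation element. -/
def TraceCondition [Finite A] [ActivationAlgebra A] (F : ℕ ⥤ TraceCat.{w, z} A) : Prop :=
  ∃ (S : ℕ → ℕ) (hS : StrictMono S) (s : ∀ i, ((hS.monotone.functor ⋙ F).obj i).carrier),
    ∀ i, (s i, ActivationAlgebra.act, s (i + 1)) ∈
      rel ((hS.monotone.functor ⋙ F).map (homOfLE (Nat.le_succ i)))

end TraceCat

/-- A trace interpretation: an object for each sequent and, for each rule with conclusion `Γ` and
`i`-th premise `Δ`, a morphism from the object of `Γ` to the object of `Δ`. -/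
structure TraceInterpretation (D : DerivationSystem.{u, v}) (A : Type w)
    [SemilatticeSup A] [OrderBot A] where
  obj : D.Seq → TraceCat.{w, z} A
  map : ∀ (r : D.Rule) (i : ℕ) {Γ Δ : D.Seq}, D.concl r = Γ → (D.prems r)[i]? = some Δ →
    (obj Γ ⟶ obj Δ)

namespace TraceInterpretation

variable {D : DerivationSystem.{u, v}} {A : Type w} [SemilatticeSup A] [OrderBot A]

/-- The morphism attached to one step from `t` to `s` of a branch: the morphism of the rule at
`t` for the premise at `s` if `s` is a child of `t`, and the identity if `t` is a bud with
companion `s`.  (For a given step exactly one of the two clauses applies, with unique `r`, `i`.) -/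
def stepHom (I : TraceInterpretation.{u, v, w, z} D A) (Q : Preproof D) (t s : List ℕ) :
    I.obj (Q.lab t) ⟶ I.obj (Q.lab s) :=
  ({x | (∃ (r : D.Rule) (i : ℕ) (hΓ : D.concl r = Q.lab t)
            (hΔ : (D.prems r)[i]? = some (Q.lab s)),
          Q.rule t = some r ∧ s = t ++ [i] ∧ x ∈ TraceCat.rel (I.map r i hΓ hΔ)) ∨
        (∃ h : Q.back t = some s,
          x ∈ TraceCat.rel (eqToHom (congrArg I.obj (Q.lab_back t s h))))} :
    Set ((I.obj (Q.lab t)).carrier × A × (I.obj (Q.lab s)).carrier))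

/-- The path through the trace category induced by a branch. -/
noncomputable def branchPath (I : TraceInterpretation.{u, v, w, z} D A) (Q : Preproof D)
    (b : ℕ → List ℕ) : ℕ ⥤ TraceCat.{w, z} A :=
  Functor.ofSequence (X := fun i => I.obj (Q.lab (b i))) (fun i => I.stepHom Q (b i) (b (i + 1)))

/-- The cyclic proof system induced by a trace interpretation: the proofs are the preproofs
without assumptions all of whose infinite branches satisfy the trace condition. -/
def induced [Finite A] [ActivationAlgebra A] (I : TraceInterpretation.{u, v, w, z} D A) :
    CyclicProofSystem.{u, v} where
  toDerivationSystem := D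
  proofs := {Q | Q.NoAssumptions ∧
    ∀ b : ℕ → List ℕ, Q.IsBranch b → TraceCat.TraceCondition (I.branchPath Q b)}
  no_assumptions := fun _ h => h.1

end TraceInterpretation

/-! ### Formulas of the modal `μ`-calculus -/

/-- Formulas over propositional letters `P` and variables `V`. -/
inductive Form (P : Type u) (V : Type v) where
  | prop (p : P) : Form P V
  | nprop (p : P) : Form P V
  | var (x : V) : Form P V
  | and (φ ψ : Form P V) : Form P V
  | or (φ ψ : Form P V) : Form P V
  | box (φ : Form P V) : Form P V
  | dia (φ : Form P V) : Form P V
  | mu (x : V) (φ : Form P V) : Form P V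
  | nu (x : V) (φ : Form P V) : Form P V

namespace Form

variable {P : Type u} {V : Type v}

/-- Free variables. -/
def free : Form P V → Set V
  | prop _ => ∅
  | nprop _ => ∅
  | var x => {x}
  | and φ ψ => φ.free ∪ ψ.free
  | or φ ψ => φ.free ∪ ψ.free
  | box φ => φ.free
  | dia φ => φ.free
  | mu x φ => φ.free \ {x}
  | nu x φ => φ.free \ {x}

/-- Variables bound by some quantifier. -/
def bound : Form P V → Set V
  | prop _ => ∅
  | nprop _ => ∅
  | var _ => ∅
  | and φ ψ => φ.bound ∪ ψ.bound
  | or φ ψ => φ.bound ∪ ψ.bound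
  | box φ => φ.bound
  | dia φ => φ.bound
  | mu x φ => insert x φ.bound
  | nu x φ => insert x φ.bound

/-- Variables bound by some `ν`. -/
def nuVars : Form P V → Set V
  | prop _ => ∅
  | nprop _ => ∅
  | var _ => ∅
  | and φ ψ => φ.nuVars ∪ ψ.nuVars
  | or φ ψ => φ.nuVars ∪ ψ.nuVars
  | box φ => φ.nuVars
  | dia φ => φ.nuVars
  | mu _ φ => φ.nuVars
  | nu x φ => insert x φ.nuVars

theorem finite_nuVars (φ : Form P V) : φ.nuVars.Finite := by
  induction φ with
  | prop _ => exact Set.finite_empty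
  | nprop _ => exact Set.finite_empty
  | var _ => exact Set.finite_empty
  | and _ _ h1 h2 => exact h1.union h2
  | or _ _ h1 h2 => exact h1.union h2
  | box _ h => exact h
  | dia _ h => exact h
  | mu _ _ h => exact h
  | nu x _ h => exact h.insert x

/-- Subformulas. -/
def sub : Form P V → Set (Form P V)
  | prop p => {prop p}
  | nprop p => {nprop p}
  | var x => {var x}
  | and φ ψ => insert (and φ ψ) (φ.sub ∪ ψ.sub)
  | or φ ψ => insert (or φ ψ) (φ.sub ∪ ψ.sub)
  | box φ => insert (box φ) φ.sub
  | dia φ => insert (dia φ) φ.sub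
  | mu x φ => insert (mu x φ) φ.sub
  | nu x φ => insert (nu x φ) φ.sub

/-- `x` subsumes `y` in `φ` (`x <_φ y`): some subformula `σ y. ψ` of `φ`, with `σ` one of `μ`, `ν`,
contains `x` free. -/
def Subsumes (φ : Form P V) (x y : V) : Prop :=
  ∃ ψ : Form P V, (mu y ψ ∈ φ.sub ∧ x ∈ (mu y ψ).free) ∨ (nu y ψ ∈ φ.sub ∧ x ∈ (nu y ψ).free)

/-- A formula is well-named if its subsumption relation is a strict preorder. -/
def WellNamed (φ : Form P V) : Prop :=
  (∀ x, ¬ φ.Subsumes x x) ∧ ∀ x y z, φ.Subsumes x y → φ.Subsumes y z → φ.Subsumes x z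

open Classical in
/-- Replacement of every instance of the variable `x` by `χ`.  It is used only where `x` is not
bound in the formula, which is when `φ[χ/x]` is considered to be defined. -/
noncomputable def subst (x : V) (χ : Form P V) : Form P V → Form P V
  | prop p => prop p
  | nprop p => nprop p
  | var y => if y = x then χ else var y
  | and φ ψ => and (subst x χ φ) (subst x χ ψ)
  | or φ ψ => or (subst x χ φ) (subst x χ ψ)
  | box φ => box (subst x χ φ)
  | dia φ => dia (subst x χ φ)
  | mu y φ => mu y (subst x χ φ)
  | nu y φ => nu y (subst x χ φ)

/-- `φ[μx.φ/x]`. -/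
noncomputable def unfoldMu (x : V) (φ : Form P V) : Form P V := subst x (mu x φ) φ

/-- `φ[νx.φ/x]`. -/
noncomputable def unfoldNu (x : V) (φ : Form P V) : Form P V := subst x (nu x φ) φ

end Form

/-! ### The cyclic modal `μ`-calculus -/

/-- Sequents: finite sets of well-named formulas. -/
structure KSeq (P : Type u) (V : Type v) where
  forms : Set (Form P V)
  finite : forms.Finite
  wellNamed : ∀ φ ∈ forms, φ.WellNamed

/-- Rule instances.  Each records its context `Γ`, its principal formula, its conclusion `S` and
its premises.  As sequents are sets, the context may contain the principal formula. -/
inductive KRule (P : Type u) (V : Type v) where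
  | ax (p : P) (S : KSeq P V) (hS : S.forms = {Form.prop p, Form.nprop p})
  | wk (Γ : Set (Form P V)) (φ : Form P V) (S S₁ : KSeq P V)
      (hS : S.forms = Γ ∪ {φ}) (h₁ : S₁.forms = Γ)
  | or (Γ : Set (Form P V)) (φ ψ : Form P V) (S S₁ : KSeq P V)
      (hS : S.forms = Γ ∪ {Form.or φ ψ}) (h₁ : S₁.forms = Γ ∪ {φ, ψ})
  | and (Γ : Set (Form P V)) (φ ψ : Form P V) (S S₁ S₂ : KSeq P V)
      (hS : S.forms = Γ ∪ {Form.and φ ψ}) (h₁ : S₁.forms = Γ ∪ {φ}) (h₂ : S₂.forms = Γ ∪ {ψ})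
  | mod (Γ : Set (Form P V)) (φ : Form P V) (S S₁ : KSeq P V)
      (hS : S.forms = Form.dia '' Γ ∪ {Form.box φ}) (h₁ : S₁.forms = Γ ∪ {φ})
  | mu (Γ : Set (Form P V)) (x : V) (φ : Form P V) (hx : x ∉ φ.bound) (S S₁ : KSeq P V)
      (hS : S.forms = Γ ∪ {Form.mu x φ}) (h₁ : S₁.forms = Γ ∪ {Form.unfoldMu x φ})
  | nu (Γ : Set (Form P V)) (x : V) (φ : Form P V) (hx : x ∉ φ.bound) (S S₁ : KSeq P V)
      (hS : S.forms = Γ ∪ {Form.nu x φ}) (h₁ : S₁.forms = Γ ∪ {Form.unfoldNu x φ})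

namespace KRule

variable {P : Type u} {V : Type v}

def concl : KRule P V → KSeq P V
  | ax _ S _ => S
  | wk _ _ S _ _ _ => S
  | or _ _ _ S _ _ _ => S
  | and _ _ _ S _ _ _ _ _ => S
  | mod _ _ S _ _ _ => S
  | mu _ _ _ _ S _ _ _ => S
  | nu _ _ _ _ S _ _ _ => S

def prems : KRule P V → List (KSeq P V)
  | ax _ _ _ => []
  | wk _ _ _ S₁ _ _ => [S₁]
  | or _ _ _ _ S₁ _ _ => [S₁]
  | and _ _ _ _ S₁ S₂ _ _ _ => [S₁, S₂]
  | mod _ _ _ S₁ _ _ => [S₁]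
  | mu _ _ _ _ _ S₁ _ _ => [S₁]
  | nu _ _ _ _ _ S₁ _ _ => [S₁]

/-- `r.Precursor i χ χ'`: the formula `χ'` of premise number `i` is a precursor of the formula `χ`
of the conclusion: a context formula is its own precursor, and the precursors of the principal
formula are the formulas which the rule replaces it with.  All formulas are principal in `mod`. -/
def Precursor : KRule P V → ℕ → Form P V → Form P V → Prop
  | ax _ _ _, _, _, _ => False
  | wk Γ _ _ _ _ _, _, χ, χ' => χ ∈ Γ ∧ χ' = χ
  | or Γ φ ψ _ _ _ _, _, χ, χ' =>
      (χ ∈ Γ ∧ χ' = χ) ∨ (χ = Form.or φ ψ ∧ (χ' = φ ∨ χ' = ψ))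
  | and Γ φ ψ _ _ _ _ _ _, i, χ, χ' =>
      (χ ∈ Γ ∧ χ' = χ) ∨ (χ = Form.and φ ψ ∧ ((i = 0 ∧ χ' = φ) ∨ (i = 1 ∧ χ' = ψ)))
  | mod Γ φ _ _ _ _, _, χ, χ' =>
      (χ' ∈ Γ ∧ χ = Form.dia χ') ∨ (χ = Form.box φ ∧ χ' = φ)
  | mu Γ x φ _ _ _ _ _, _, χ, χ' =>
      (χ ∈ Γ ∧ χ' = χ) ∨ (χ = Form.mu x φ ∧ χ' = Form.unfoldMu x φ)
  | nu Γ x φ _ _ _ _ _, _, χ, χ' =>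
      (χ ∈ Γ ∧ χ' = χ) ∨ (χ = Form.nu x φ ∧ χ' = Form.unfoldNu x φ)

open Classical in
/-- The label of the trace step from `(χ, x)` to `(χ', x)`: `2` (failure) if a `μ`-quantifier
binding a variable that subsumes `x` is unfolded, `1` (progress) if `νx` is unfolded, else `0`. -/
noncomputable def label : KRule P V → Form P V → Form P V → V → Fin 3
  | mu _ y θ _ _ _ _ _, χ, χ', x =>
      if χ = Form.mu y θ ∧ χ' = Form.unfoldMu y θ ∧ χ.Subsumes y x then 2 else 0
  | nu _ y θ _ _ _ _ _, χ, χ', x =>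
      if χ = Form.nu y θ ∧ χ' = Form.unfoldNu y θ ∧ y = x then 1 else 0
  | _, _, _, _ => 0

end KRule

/-- The derivation system of the modal `μ`-calculus. -/
abbrev kDer (P : Type u) (V : Type v) : DerivationSystem.{max u v, max u v} where
  Seq := KSeq P V
  Rule := KRule P V
  concl := KRule.concl
  prems := KRule.prems

/-- The trace object of a sequent: pairs of a formula in it and a variable `ν`-bound in that
formula. -/
def KSeq.TracePoint {P : Type u} {V : Type v} (Γ : KSeq P V) : Type (max u v) :=
  {q : Form P V × V // q.1 ∈ Γ.forms ∧ q.2 ∈ q.1.nuVars}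

theorem KSeq.finite_tracePoint {P : Type u} {V : Type v} (Γ : KSeq P V) :
    Finite Γ.TracePoint := by
  have h : (⋃ φ ∈ Γ.forms, (fun x => (φ, x)) '' φ.nuVars).Finite :=
    Γ.finite.biUnion fun φ _ => φ.finite_nuVars.image _
  have h' : {q : Form P V × V | q.1 ∈ Γ.forms ∧ q.2 ∈ q.1.nuVars}.Finite := by
    refine h.subset ?_
    rintro ⟨φ, x⟩ ⟨h1, h2⟩
    simp only [Set.mem_iUnion]
    exact ⟨φ, h1, x, h2, rfl⟩
  exact h'.to_subtype

/-- The trace interpretation of the modal `μ`-calculus over the failure algebra. -/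
noncomputable def failureTrace (P : Type u) (V : Type v) :
    TraceInterpretation.{max u v, max u v, 0, max u v} (kDer P V) (Fin 3) where
  obj Γ := ⟨KSeq.TracePoint Γ, KSeq.finite_tracePoint Γ⟩
  map r i Γ Δ _ _ :=
    ({t | t.1.1.2 = t.2.2.1.2 ∧ KRule.Precursor r i t.1.1.1 t.2.2.1.1 ∧
        t.2.1 = KRule.label r t.1.1.1 t.2.2.1.1 t.1.1.2} :
      Set (KSeq.TracePoint Γ × Fin 3 × KSeq.TracePoint Δ))

/-- The cyclic proof system `K_μ` with the global trace condition over the failure algebra. -/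
noncomputable def kMu (P : Type u) (V : Type v) : CyclicProofSystem.{max u v, max u v} :=
  (failureTrace P V).induced

/-! ### The `𝔽`-reset modal `μ`-calculus -/

/-- Annotations: a sequence of letters for each variable.  An annotation of `φ` is a function on
the `ν`-bound variables of `φ`; it is represented by its extension with the empty sequence. -/
abbrev Annot (V : Type v) (C : Type w) := V → List C

namespace Annot

variable {P : Type u} {V : Type v} {C : Type w}

/-- The annotation with empty sequences only. -/
def empty : Annot V C := fun _ => []

open Classical in
/-- Removal of the assignments to variables that are not `ν`-bound in `φ`. -/
noncomputable def restrict (σ : Annot V C) (φ : Form P V) : Annot V C :=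
  fun x => if x ∈ φ.nuVars then σ x else []

open Classical in
/-- `σ ∖ x` for the unfolding of `μx.φ`: the variables subsumed by `x` are reset to `ε`. -/
noncomputable def drop (σ : Annot V C) (x : V) (φ : Form P V) : Annot V C :=
  fun y => if (Form.mu x φ).Subsumes x y then [] else σ y

open Classical in
/-- Append the letter `a` to the sequence assigned to `x`. -/
noncomputable def push (σ : Annot V C) (x : V) (a : C) : Annot V C :=
  fun y => if y = x then σ x ++ [a] else σ y

end Annot

section Sequences

variable {V : Type v} {C : Type w}

open Classical in
/-- The reset of a sequence: `u a v` becomes `u a`; sequences without `a` are unchanged. -/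
noncomputable def resetList (a : C) (s : List C) : List C :=
  if a ∈ s then s.takeWhile (fun b => decide (b ≠ a)) ++ [a] else s

/-- The order `<_Θ` on sequences of letters from `Θ`: `s` contains the `Θ`-least letter which
occurs in exactly one of `s` and `t`. -/
def ctrlLt (Θ : List C) (s t : List C) : Prop :=
  ∃ (l r : List C) (a : C), Θ = l ++ a :: r ∧ a ∈ s ∧ a ∉ t ∧ ∀ b ∈ l, (b ∈ s ↔ b ∈ t)

open Classical in
/-- The `<_Θ`-minimum of two sequences. -/
noncomputable def ctrlMin (Θ : List C) (s t : List C) : List C :=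
  if ctrlLt Θ t s then t else s

/-- The pointwise `<_Θ`-minimum of two annotations. -/
noncomputable def Annot.merge (Θ : List C) (σ τ : Annot V C) : Annot V C :=
  fun x => ctrlMin Θ (σ x) (τ x)

end Sequences

/-- Sets of annotated formulas. -/
abbrev AForms (P : Type u) (V : Type v) (C : Type w) := Set (Form P V × Annot V C)

namespace AForms

variable {P : Type u} {V : Type v} {C : Type w}

/-- The letter `a` occurs in some annotation. -/
def Occurs (Γ : AForms P V C) (a : C) : Prop :=
  ∃ φσ ∈ Γ, ∃ x ∈ φσ.1.nuVars, a ∈ φσ.2 x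

/-- The letter `a` is never the last letter of a sequence assigned by some annotation. -/
def Covered (Γ : AForms P V C) (a : C) : Prop :=
  ∀ φσ ∈ Γ, ∀ x ∈ φσ.1.nuVars, a ∈ φσ.2 x → (φσ.2 x).getLast? ≠ some a

/-- `◇Γ`. -/
def dia (Γ : AForms P V C) : AForms P V C :=
  (fun φσ => (Form.dia φσ.1, φσ.2)) '' Γ

/-- The `a`-reset of all annotations. -/
noncomputable def reset (Γ : AForms P V C) (a : C) : AForms P V C :=
  (fun φσ => (φσ.1, fun x => resetList a (φσ.2 x))) '' Γ

open Classical in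
/-- The control obtained from `Θ` by removing all letters which do not occur in `Γ`. -/
noncomputable def prune (Γ : AForms P V C) (Θ : List C) : List C :=
  Θ.filter (fun a => decide (Γ.Occurs a))

end AForms

/-- Annotated sequents `Θ | Γ`: the control `Θ` is a sequence of distinct letters, and `Γ` is a
finite set of well-named formulas, each annotated with an assignment of subsequences of `Θ` to its
`ν`-bound variables. -/
@[ext]
structure RSeq (P : Type u) (V : Type v) (C : Type w) where
  ctrl : List C
  forms : AForms P V C
  nodup : ctrl.Nodup
  finite : forms.Finite
  wellNamed : ∀ φσ ∈ forms, φσ.1.WellNamed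
  sublist : ∀ φσ ∈ forms, ∀ x, (φσ.2 x).Sublist ctrl
  support : ∀ φσ ∈ forms, ∀ x, x ∉ φσ.1.nuVars → φσ.2 x = []

/-- Rule instances.  `S` is the conclusion, `S₁` and `S₂` are the premises. -/
inductive RRule (P : Type u) (V : Type v) (C : Type w) where
  | ax (p : P) (S : RSeq P V C)
      (hS : S.forms = {(Form.prop p, Annot.empty), (Form.nprop p, Annot.empty)})
  | wk (Γ : AForms P V C) (φ : Form P V) (σ : Annot V C) (S S₁ : RSeq P V C)
      (hS : S.forms = Γ ∪ {(φ, σ)})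
      (h₁ : S₁.forms = Γ) (c₁ : S₁.ctrl = S₁.forms.prune S.ctrl)
  | or (Γ : AForms P V C) (φ ψ : Form P V) (σ : Annot V C) (S S₁ : RSeq P V C)
      (hS : S.forms = Γ ∪ {(Form.or φ ψ, σ)})
      (h₁ : S₁.forms = Γ ∪ {(φ, σ.restrict φ), (ψ, σ.restrict ψ)}) (c₁ : S₁.ctrl = S.ctrl)
  | and (Γ : AForms P V C) (φ ψ : Form P V) (σ : Annot V C) (S S₁ S₂ : RSeq P V C)
      (hS : S.forms = Γ ∪ {(Form.and φ ψ, σ)})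
      (h₁ : S₁.forms = Γ ∪ {(φ, σ.restrict φ)}) (c₁ : S₁.ctrl = S₁.forms.prune S.ctrl)
      (h₂ : S₂.forms = Γ ∪ {(ψ, σ.restrict ψ)}) (c₂ : S₂.ctrl = S₂.forms.prune S.ctrl)
  | mod (Γ : AForms P V C) (φ : Form P V) (σ : Annot V C) (S S₁ : RSeq P V C)
      (hS : S.forms = Γ.dia ∪ {(Form.box φ, σ)})
      (h₁ : S₁.forms = Γ ∪ {(φ, σ)}) (c₁ : S₁.ctrl = S.ctrl)
  | mu (Γ : AForms P V C) (x : V) (φ : Form P V) (hx : x ∉ φ.bound) (σ : Annot V C)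
      (S S₁ : RSeq P V C) (hS : S.forms = Γ ∪ {(Form.mu x φ, σ)})
      (h₁ : S₁.forms = Γ ∪ {(Form.unfoldMu x φ, σ.drop x φ)})
      (c₁ : S₁.ctrl = S₁.forms.prune S.ctrl)
  | nu (Γ : AForms P V C) (x : V) (φ : Form P V) (hx : x ∉ φ.bound) (σ : Annot V C) (a : C)
      (S S₁ : RSeq P V C) (ha : a ∉ S.ctrl) (hS : S.forms = Γ ∪ {(Form.nu x φ, σ)})
      (h₁ : S₁.forms =
        Γ ∪ {(Form.unfoldNu x φ, (σ.push x a).restrict (Form.unfoldNu x φ))})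
      (c₁ : S₁.ctrl = S.ctrl ++ [a])
  | reset (a : C) (S S₁ : RSeq P V C) (ha : a ∈ S.ctrl) (hcov : S.forms.Covered a)
      (h₁ : S₁.forms = S.forms.reset a) (c₁ : S₁.ctrl = S₁.forms.prune S.ctrl)
  | merge (Γ : AForms P V C) (φ : Form P V) (σ τ : Annot V C) (S S₁ : RSeq P V C)
      (hS : S.forms = Γ ∪ {(φ, σ), (φ, τ)})
      (h₁ : S₁.forms = Γ ∪ {(φ, Annot.merge S.ctrl σ τ)})
      (c₁ : S₁.ctrl = S₁.forms.prune S.ctrl)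

namespace RRule

variable {P : Type u} {V : Type v} {C : Type w}

def concl : RRule P V C → RSeq P V C
  | ax _ S _ => S
  | wk _ _ _ S _ _ _ _ => S
  | or _ _ _ _ S _ _ _ _ => S
  | and _ _ _ _ S _ _ _ _ _ _ _ => S
  | mod _ _ _ S _ _ _ _ => S
  | mu _ _ _ _ _ S _ _ _ _ => S
  | nu _ _ _ _ _ _ S _ _ _ _ _ => S
  | reset _ S _ _ _ _ _ => S
  | merge _ _ _ _ S _ _ _ _ => S

def prems : RRule P V C → List (RSeq P V C)
  | ax _ _ _ => []
  | wk _ _ _ _ S₁ _ _ _ => [S₁]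
  | or _ _ _ _ _ S₁ _ _ _ => [S₁]
  | and _ _ _ _ _ S₁ S₂ _ _ _ _ _ => [S₁, S₂]
  | mod _ _ _ _ S₁ _ _ _ => [S₁]
  | mu _ _ _ _ _ _ S₁ _ _ _ => [S₁]
  | nu _ _ _ _ _ _ _ S₁ _ _ _ _ => [S₁]
  | reset _ _ S₁ _ _ _ _ => [S₁]
  | merge _ _ _ _ _ S₁ _ _ _ => [S₁]

/-- The rule is an instance of the reset rule for the letter `a`. -/
def IsReset (a : C) : RRule P V C → Prop
  | reset b _ _ _ _ _ _ => b = a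
  | _ => False

end RRule

/-- The derivation system of the `𝔽`-reset modal `μ`-calculus. -/
abbrev rkDer (P : Type u) (V : Type v) (C : Type w) :
    DerivationSystem.{max u v w, max u v w} where
  Seq := RSeq P V C
  Rule := RRule P V C
  concl := RRule.concl
  prems := RRule.prems

/-- The path from the companion `c` to the bud `t` has an invariant: a letter `a` which occurs in
all controls between `c` and `t`, always with the same prefix `l` before it, such that the reset
rule for `a` is applied between `c` and `t`. -/
def HasInvariant {P : Type u} {V : Type v} {C : Type w} (Q : Preproof (rkDer P V C))
    (c t : List ℕ) : Prop :=
  ∃ (a : C) (l : List C),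
    (∀ s, c <+: s → s <+: t → ∃ r : List C, RSeq.ctrl (Q.lab s) = l ++ a :: r) ∧
    ∃ (s : List ℕ) (ρ : RRule P V C),
      c <+: s ∧ s <+: t ∧ Q.rule s = some ρ ∧ ρ.IsReset a

/-- The cyclic proof system `RK_μ^𝔽`. -/
def rkMu (P : Type u) (V : Type v) (C : Type w) :
    CyclicProofSystem.{max u v w, max u v w} where
  toDerivationSystem := rkDer P V C
  proofs := {Q | Q.NoAssumptions ∧ ∀ t c, Q.back t = some c → HasInvariant Q c t}
  no_assumptions := fun _ h => h.1

/-- The un-annotated sequent. -/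
def RSeq.strip {P : Type u} {V : Type v} {C : Type w} (S : RSeq P V C) : KSeq P V where
  forms := Prod.fst '' S.forms
  finite := S.finite.image _
  wellNamed := by
    rintro _ ⟨φσ, h, rfl⟩
    exact S.wellNamed φσ h

/-- The annotated sequent `ε | {(φ, ε) : φ ∈ Γ}`. -/
def KSeq.annotate {P : Type u} {V : Type v} (Γ : KSeq P V) (C : Type w) : RSeq P V C where
  ctrl := []
  forms := (fun φ => (φ, Annot.empty)) '' Γ.forms
  nodup := List.nodup_nil
  finite := Γ.finite.image _
  wellNamed := by
    rintro _ ⟨φ, h, rfl⟩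
    exact Γ.wellNamed φ h
  sublist := by
    rintro _ ⟨φ, h, rfl⟩ x
    exact List.nil_sublist _
  support := by
    rintro _ ⟨φ, h, rfl⟩ x _
    rfl

/-- `RK_μ^𝔽 ⊢ Γ` for a sequent `Γ` of plain formulas. -/
def rkProves (P : Type u) (V : Type v) (C : Type w) (Γ : KSeq P V) : Prop :=
  (rkMu P V C).Proves (Γ.annotate C)

end CyclicMu

namespace CyclicMu

universe u v w

/-! ### Infinite branches -/

namespace Preproof.IsBranch

variable {D : DerivationSystem.{u, v}} {Q : Preproof D} {b : ℕ → List ℕ}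

/-! Erasing annotations turns an `RK_μ^𝔽`-proof into a `K_μ`-preproof on the same cyclic tree:
`Reset` and `Merge` change only annotations and become weakenings by a formula that stays in the
context. It remains to find a progressing trace on every infinite branch.

By `exists_stable_letter`, some letter `a` is eventually in every control and is reset infinitely
often. Traces are built backwards (`RRule.TracesBack`): a letter already in the control of the
conclusion, and occurring in an annotation of a premise at `x`, also occurs at `x` in an annotation
of a precursor's formula in the conclusion. Such a step never has label 2, because unfolding `μy`
empties the sequences of the variables subsumed by `y`. Only unfolding `νx` appends a letter at `x`,
and this is progress.

Just after a reset of `a`, every sequence containing `a` ends in `a`; just before the next one, none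
does, since `a` is covered. So a trace between two resets must progress, with composite label 1. The
trace points carrying `a` after each reset form finite nonempty levels in which every point has such
a predecessor, and König's lemma (`exists_compatible_of_finite`) gives an infinite trace. -/

theorem mem_nodes (h : Q.IsBranch b) (i : ℕ) : b i ∈ Q.nodes := by
  induction i with
  | zero => rw [h.zero]; exact Q.nil_mem
  | succ i _ =>
    by_cases hl : Q.IsLeaf (b i)
    · exact (Q.back_inner _ _ (h.leaf i hl)).1
    · exact (h.inner i hl).1

theorem step (h : Q.IsBranch b) (i : ℕ) :
    Q.back (b i) = some (b (i + 1)) ∨ (¬ Q.IsLeaf (b i) ∧ ∃ j, b (i + 1) = b i ++ [j]) := by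
  by_cases hl : Q.IsLeaf (b i)
  · exact .inl (h.leaf i hl)
  · exact .inr ⟨hl, (h.inner i hl).2⟩

/-- A branch can enter the subtree above `s` only through `s`. -/
theorem exists_eq_of_enters (h : Q.IsBranch b) {s : List ℕ} {i j : ℕ} (hij : i ≤ j)
    (hi : ¬ s <+: b i) (hj : s <+: b j) : ∃ k, i < k ∧ k ≤ j ∧ b k = s := by
  induction j, hij using Nat.le_induction with
  | base => exact absurd hj hi
  | succ n hn ih =>
    by_cases hs : s <+: b n
    · obtain ⟨k, h1, h2, h3⟩ := ih hs
      exact ⟨k, h1, by omega, h3⟩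
    · rcases h.step n with hb | ⟨_, m, hm⟩
      -- A companion is a prefix of its bud, so a jump back cannot enter the subtree.
      · exact absurd (hj.trans (Q.back_lt _ _ hb).1) hs
      · rw [hm, List.prefix_concat_iff] at hj
        rcases hj with hj | hj
        · exact ⟨n + 1, by omega, le_rfl, by rw [hm, hj]⟩
        · exact absurd hj hs

/-- A branch can leave the subtree above `s` only from a bud to its companion. -/
theorem exists_back_of_leaves (h : Q.IsBranch b) {s : List ℕ} {i j : ℕ} (hij : i ≤ j)
    (hi : s <+: b i) (hj : ¬ s <+: b j) :
    ∃ k, i ≤ k ∧ s <+: b k ∧ Q.back (b k) = some (b (k + 1)) ∧ ¬ s <+: b (k + 1) := by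
  induction j, hij using Nat.le_induction with
  | base => exact absurd hi hj
  | succ n hn ih =>
    by_cases hs : s <+: b n
    · rcases h.step n with hb | ⟨_, m, hm⟩
      · exact ⟨n, hn, hs, hb, hj⟩
      · exact absurd (hs.trans (by rw [hm]; exact List.prefix_append _ _)) hj
    · exact ih hs

/-- The tree is finite, so the nodes visited only finitely often are all abandoned from some index
on. -/
theorem exists_recurrent (h : Q.IsBranch b) :
    ∃ N, ∀ i, N ≤ i → ∀ M, ∃ j, M ≤ j ∧ b j = b i := by
  have hF : (⋃ s ∈ {s | s ∈ Q.nodes ∧ {i | b i = s}.Finite}, {i | b i = s}).Finite :=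
    (Q.finite.subset fun s hs => hs.1).biUnion fun s hs => hs.2
  obtain ⟨B, hB⟩ := hF.bddAbove
  refine ⟨B + 1, fun i hi M => ?_⟩
  by_contra! hM
  have hfin : {j | b j = b i}.Finite :=
    (Set.finite_lt_nat M).subset fun j hj => lt_of_not_ge fun hMj => hM j hMj hj
  have : i ≤ B := hB (by
    simp only [Set.mem_iUnion]
    exact ⟨b i, ⟨h.mem_nodes i, hfin⟩, rfl⟩)
  omega

/-- A recurrent step lies on the path from some companion to its bud. -/
theorem exists_back_around (h : Q.IsBranch b) {i : ℕ} (hi : ∃ j, i + 1 ≤ j ∧ b j = b i) :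
    ∃ k, i ≤ k ∧ Q.back (b k) = some (b (k + 1)) ∧ b (k + 1) <+: b i ∧ b i <+: b k ∧
      b (k + 1) <+: b (i + 1) ∧ b (i + 1) <+: b k := by
  rcases h.step i with hb | ⟨_, m, hm⟩
  · have := (Q.back_lt _ _ hb).1
    exact ⟨i, le_rfl, hb, this, List.prefix_rfl, List.prefix_rfl, this⟩
  · obtain ⟨j, hj, hji⟩ := hi
    -- To return to `b i` from its child, the branch must leave the subtree above that child, which
    -- only a back edge can do. The companion is then a proper prefix of the child, hence a prefix
    -- of `b i`.
    have hnot : ¬ b (i + 1) <+: b j := fun hp => by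
      have := hp.length_le
      simp [hji, hm] at this
    obtain ⟨k, hk, hpre, hback, hout⟩ := h.exists_back_of_leaves hj List.prefix_rfl hnot
    have hlt : b (k + 1) <+: b (i + 1) :=
      (List.prefix_or_prefix_of_prefix (Q.back_lt _ _ hback).1 hpre).resolve_right hout
    have hi1 : b i <+: b (i + 1) := by rw [hm]; exact List.prefix_append _ _
    refine ⟨k, by omega, hback, ?_, hi1.trans hpre, hlt, hpre⟩
    rw [hm, List.prefix_concat_iff] at hlt
    rcases hlt with hlt | hlt
    · exact absurd (by rw [hlt, hm]) hout
    · exact hlt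

end Preproof.IsBranch

/-- Every branch of an `RK_μ^𝔽`-proof has a letter that eventually belongs to all controls and is
reset infinitely often. -/
theorem exists_stable_letter {P : Type u} {V : Type v} {C : Type w} {Q : Preproof (rkDer P V C)}
    (hQ : ∀ t c, Q.back t = some c → HasInvariant Q c t) {b : ℕ → List ℕ} (h : Q.IsBranch b) :
    ∃ (a : C) (N : ℕ), (∀ i, N ≤ i → a ∈ RSeq.ctrl (Q.lab (b i))) ∧
      ∀ M, ∃ i, M ≤ i ∧ ∃ ρ : RRule P V C, Q.rule (b i) = some ρ ∧ ρ.IsReset a := by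
  classical
  obtain ⟨N, hN⟩ := h.exists_recurrent
  -- Different back edges may have different invariants. The letter is taken from an invariant with
  -- the shortest prefix `l` among the back edges used after `N`.
  let Inv (m : ℕ) : Prop := ∃ (k : ℕ) (a : C) (l : List C), N ≤ k ∧
    Q.back (b k) = some (b (k + 1)) ∧ l.length = m ∧
    (∀ s, b (k + 1) <+: s → s <+: b k → ∃ r : List C, RSeq.ctrl (Q.lab s) = l ++ a :: r) ∧
    ∃ (s : List ℕ) (ρ : RRule P V C),
      b (k + 1) <+: s ∧ s <+: b k ∧ Q.rule s = some ρ ∧ ρ.IsReset a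
  have hInv : ∃ m, Inv m := by
    obtain ⟨k, hk, hback, -⟩ := h.exists_back_around (hN N le_rfl _)
    obtain ⟨a, l, h1, h2⟩ := hQ _ _ hback
    exact ⟨l.length, k, a, l, hk, hback, rfl, h1, h2⟩
  have hmin := fun m => Nat.find_min' hInv (m := m)
  obtain ⟨k₀, a, l, hk₀, hback₀, hlen, hctrl, s, ρ, hcs, hst, hρ, hreset⟩ := Nat.find_spec hInv
  rw [← hlen] at hmin
  have hconst : ∀ i, N ≤ i → (RSeq.ctrl (Q.lab (b i))).take (l.length + 1) =
      (RSeq.ctrl (Q.lab (b N))).take (l.length + 1) := by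
    intro i hi
    induction i, hi using Nat.le_induction with
    | base => rfl
    | succ i hi ih =>
      rw [← ih]
      obtain ⟨k, hk, hback, h1, h2, h3, h4⟩ := h.exists_back_around (hN i hi _)
      obtain ⟨a', l', hc, hr⟩ := hQ _ _ hback
      have hle := hmin l'.length ⟨k, a', l', hi.trans hk, hback, rfl, hc, hr⟩
      obtain ⟨r₁, hr₁⟩ := hc _ h1 h2
      obtain ⟨r₂, hr₂⟩ := hc _ h3 h4
      -- Each step lies inside a cycle whose controls all begin with `l' ++ [a']`. By minimality
      -- this is at least as long as `l ++ [a]`, so the step preserves the first `l.length + 1`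
      -- letters.
      have key : ∀ r : List C, (l' ++ a' :: r).take (l.length + 1) =
          (l' ++ [a']).take (l.length + 1) := fun r => by
        rw [show l' ++ a' :: r = (l' ++ [a']) ++ r by simp, List.take_append_of_le_length]
        simpa using hle
      rw [hr₁, hr₂, key r₁, key r₂]
  refine ⟨a, N, fun i hi => ?_, fun M => ?_⟩
  · obtain ⟨r, hr⟩ := hctrl _ (Q.back_lt _ _ hback₀).1 List.prefix_rfl
    have h1 := (hconst i hi).trans (hconst k₀ hk₀).symm
    rw [hr] at h1
    exact List.mem_of_mem_take (i := l.length + 1) (by rw [h1]; simp [List.take_append])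
  · obtain ⟨j₁, hj₁, hb₁⟩ := hN k₀ hk₀ M
    have hnext : b (j₁ + 1) = b (k₀ + 1) := by
      have hl := h.leaf j₁ (by rw [hb₁]; exact Q.back_leaf _ _ hback₀)
      rw [hb₁, hback₀] at hl
      exact (Option.some.inj hl).symm
    -- Between two visits to the bud the branch restarts at the companion. Either the reset node `s`
    -- is the companion itself, or the subtree above `s` is re-entered, necessarily through `s`.
    obtain ⟨j₂, hj₂, hb₂⟩ := hN k₀ hk₀ (j₁ + 1)
    by_cases hs : s <+: b (j₁ + 1)
    · refine ⟨j₁ + 1, by omega, ρ, ?_, hreset⟩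
      rw [hnext] at hs ⊢
      rwa [List.IsPrefix.eq_of_length_le hcs hs.length_le]
    · obtain ⟨k, hk, -, hbk⟩ := h.exists_eq_of_enters hj₂ hs (by rwa [hb₂])
      exact ⟨k, by omega, ρ, by rwa [hbk], hreset⟩

/-! ### Rules -/

theorem KSeq.ext_forms {P : Type u} {V : Type v} {S T : KSeq P V} (h : S.forms = T.forms) :
    S = T := by
  cases S; cases T; cases h; rfl

/-- Labels compare formulas, not occurrences, so a context step could get label 2 if a `μ`-formula
equals its own unfolding. This happens only for `μx.x`, which has no `ν`-variables and so no trace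
points. -/
theorem Form.eq_var_of_unfoldMu_eq {P : Type u} {V : Type v} {x : V} {φ : Form P V}
    (hx : x ∉ φ.bound) (h : unfoldMu x φ = mu x φ) : φ = var x := by
  cases φ with
  | var y =>
    by_cases hy : y = x
    · rw [hy]
    · simp [unfoldMu, subst, hy] at h
  | mu y ψ =>
    simp only [unfoldMu, subst, mu.injEq] at h
    exact absurd (by simp [bound, h.1]) hx
  | _ => simp [unfoldMu, subst] at h

/-- If `u b v` is cut to `u b` and `a` survives without being last, then `a` lies in `u`; as letters
are distinct, it is not last in `u b v` either. -/
theorem not_last_of_resetList {C : Type w} {a b : C} {s : List C} (ha : a ∈ resetList b s) :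
    a ∈ s ∧ (s.Nodup → (resetList b s).getLast? ≠ some a → s.getLast? ≠ some a) := by
  classical
  unfold resetList at *
  split_ifs at * with hb
  · have hmem : a ∈ s := by
      rcases List.mem_append.1 ha with h | h
      · exact (List.takeWhile_sublist _).mem h
      · rwa [List.mem_singleton.1 h]
    refine ⟨hmem, fun hnd hl hlast => ?_⟩
    have hab : a ≠ b := by rintro rfl; simp at hl
    have ha' : a ∈ s.takeWhile (fun c => decide (c ≠ b)) := by
      rcases List.mem_append.1 ha with h | h
      · exact h
      · exact absurd (List.mem_singleton.1 h) hab
    have hsplit := List.takeWhile_append_dropWhile (p := fun c => decide (c ≠ b)) (l := s)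
    have hdrop : s.dropWhile (fun c => decide (c ≠ b)) ≠ [] := by
      intro h0
      rw [h0, List.append_nil] at hsplit
      rw [← hsplit] at hb
      simpa using List.mem_takeWhile_imp hb
    rw [← hsplit] at hnd hlast
    rw [List.getLast?_append_of_ne_nil _ hdrop] at hlast
    exact (List.nodup_append.1 hnd).2.2 a ha' a (List.mem_of_getLast? hlast) rfl
  · exact ⟨ha, fun _ => id⟩

theorem getLast?_resetList {C : Type w} {a : C} {s : List C} (ha : a ∈ resetList a s) :
    (resetList a s).getLast? = some a := by
  classical
  unfold resetList at *
  split_ifs at * with h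
  · simp
  · exact absurd ha h

/-- A trace step for the letter `a` from an annotated formula of the conclusion to one of a
premise, progressing unless it preserves that `a` is not the last letter. -/
def RRule.TracesBack {P : Type u} {V : Type v} {C : Type w} (r : RRule P V C) (k : KRule P V) :
    Prop :=
  ∀ (a : C) (i : ℕ) (Δ : RSeq P V C), r.prems[i]? = some Δ → a ∈ r.concl.ctrl →
    ∀ (φ' : Form P V) (σ' : Annot V C) (x : V), (φ', σ') ∈ Δ.forms → a ∈ σ' x →
      ∃ (φ : Form P V) (σ : Annot V C), (φ, σ) ∈ r.concl.forms ∧ a ∈ σ x ∧ k.Precursor i φ φ' ∧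
        (k.label φ φ' x = 1 ∨
          k.label φ φ' x = 0 ∧ ((σ' x).getLast? ≠ some a → (σ x).getLast? ≠ some a))

theorem RSeq.mem_nuVars {P : Type u} {V : Type v} {C : Type w} (S : RSeq P V C)
    {φ : Form P V} {σ : Annot V C} {x : V} {a : C} (h : (φ, σ) ∈ S.forms) (ha : a ∈ σ x) :
    x ∈ φ.nuVars := by
  by_contra hx
  have := S.support _ h x hx
  simp_all

theorem Annot.mem_restrict {P : Type u} {V : Type v} {C : Type w} {σ : Annot V C} {φ : Form P V}
    {x : V} {a : C} (h : a ∈ σ.restrict φ x) : σ.restrict φ x = σ x := by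
  unfold restrict at *
  split_ifs at * with h1
  · rfl
  · simp at h

/-- A letter that survives the unfolding of `μy` certifies that the trace step is not a failure. -/
theorem Annot.mem_drop {P : Type u} {V : Type v} {C : Type w} {σ : Annot V C} {φ : Form P V}
    {x y : V} {a : C} (h : a ∈ σ.drop y φ x) :
    ¬ (Form.mu y φ).Subsumes y x ∧ σ.drop y φ x = σ x := by
  unfold drop at *
  split_ifs at * with h1
  · simp at h
  · exact ⟨h1, rfl⟩

/-- Every rule maps to its namesake, except `Reset` and `Merge`, which map to weakening.
Nonemptiness provides the formula to weaken by in the case of `Reset`. -/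
theorem RRule.exists_tracesBack {P : Type u} {V : Type v} {C : Type w} (r : RRule P V C)
    (hne : r.concl.forms.Nonempty) :
    ∃ k : KRule P V, k.concl = r.concl.strip ∧ k.prems = r.prems.map RSeq.strip ∧
      r.TracesBack k := by
  cases r with
  | ax p S hS =>
    refine ⟨.ax p S.strip (by simp [RSeq.strip, hS, Set.image_pair]), rfl, rfl, ?_⟩
    intro a i Δ hi
    simp [prems] at hi
  | wk Γ φ σ S S₁ hS h₁ c₁ =>
    refine ⟨.wk (Prod.fst '' Γ) φ S.strip S₁.strip
      (by simp [RSeq.strip, hS, Set.image_union, -Set.union_singleton])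
      (by simp [RSeq.strip, h₁]), rfl, rfl, ?_⟩
    intro a i Δ hi ha φ' σ' x hmem hx
    obtain rfl : S₁ = Δ := by
      simp only [prems, List.getElem?_singleton, Option.ite_none_right_eq_some] at hi
      exact Option.some.inj hi.2
    rw [h₁] at hmem
    exact ⟨φ', σ', hS ▸ .inl hmem, hx, ⟨⟨_, hmem, rfl⟩, rfl⟩, .inr ⟨rfl, id⟩⟩
  | or Γ φ ψ σ S S₁ hS h₁ c₁ =>
    refine ⟨.or (Prod.fst '' Γ) φ ψ S.strip S₁.strip
      (by simp [RSeq.strip, hS, Set.image_union, -Set.union_singleton])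
      (by simp [RSeq.strip, h₁, Set.image_union, Set.image_pair, -Set.union_insert]),
      rfl, rfl, ?_⟩
    intro a i Δ hi ha φ' σ' x hmem hx
    obtain rfl : S₁ = Δ := by
      simp only [prems, List.getElem?_singleton, Option.ite_none_right_eq_some] at hi
      exact Option.some.inj hi.2
    rw [h₁] at hmem
    rcases hmem with hmem | hmem | hmem
    · exact ⟨φ', σ', hS ▸ .inl hmem, hx, .inl ⟨⟨_, hmem, rfl⟩, rfl⟩, .inr ⟨rfl, id⟩⟩
    · cases hmem
      have heq := Annot.mem_restrict hx
      rw [heq] at hx ⊢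
      exact ⟨_, σ, hS ▸ .inr rfl, hx, .inr ⟨rfl, .inl rfl⟩, .inr ⟨rfl, id⟩⟩
    · cases hmem
      have heq := Annot.mem_restrict hx
      rw [heq] at hx ⊢
      exact ⟨_, σ, hS ▸ .inr rfl, hx, .inr ⟨rfl, .inr rfl⟩, .inr ⟨rfl, id⟩⟩
  | and Γ φ ψ σ S S₁ S₂ hS h₁ c₁ h₂ c₂ =>
    refine ⟨.and (Prod.fst '' Γ) φ ψ S.strip S₁.strip S₂.strip
      (by simp [RSeq.strip, hS, Set.image_union, -Set.union_singleton])
      (by simp [RSeq.strip, h₁, Set.image_union, -Set.union_singleton])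
      (by simp [RSeq.strip, h₂, Set.image_union, -Set.union_singleton]), rfl, rfl, ?_⟩
    intro a i Δ hi ha φ' σ' x hmem hx
    match i, hi with
    | 0, hi =>
      obtain rfl : S₁ = Δ := Option.some.inj hi
      rw [h₁] at hmem
      rcases hmem with hmem | hmem
      · exact ⟨φ', σ', hS ▸ .inl hmem, hx, .inl ⟨⟨_, hmem, rfl⟩, rfl⟩, .inr ⟨rfl, id⟩⟩
      · cases hmem
        have heq := Annot.mem_restrict hx
        rw [heq] at hx ⊢
        exact ⟨_, σ, hS ▸ .inr rfl, hx, .inr ⟨rfl, .inl ⟨rfl, rfl⟩⟩, .inr ⟨rfl, id⟩⟩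
    | 1, hi =>
      obtain rfl : S₂ = Δ := Option.some.inj hi
      rw [h₂] at hmem
      rcases hmem with hmem | hmem
      · exact ⟨φ', σ', hS ▸ .inl hmem, hx, .inl ⟨⟨_, hmem, rfl⟩, rfl⟩, .inr ⟨rfl, id⟩⟩
      · cases hmem
        have heq := Annot.mem_restrict hx
        rw [heq] at hx ⊢
        exact ⟨_, σ, hS ▸ .inr rfl, hx, .inr ⟨rfl, .inr ⟨rfl, rfl⟩⟩, .inr ⟨rfl, id⟩⟩
    | n + 2, hi => simp [prems] at hi
  | mod Γ φ σ S S₁ hS h₁ c₁ =>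
    refine ⟨.mod (Prod.fst '' Γ) φ S.strip S₁.strip
      (by simp [RSeq.strip, hS, Set.image_union, AForms.dia, Set.image_image,
        -Set.union_singleton])
      (by simp [RSeq.strip, h₁, Set.image_union, -Set.union_singleton]), rfl, rfl, ?_⟩
    intro a i Δ hi ha φ' σ' x hmem hx
    obtain rfl : S₁ = Δ := by
      simp only [prems, List.getElem?_singleton, Option.ite_none_right_eq_some] at hi
      exact Option.some.inj hi.2
    rw [h₁] at hmem
    rcases hmem with hmem | hmem
    · exact ⟨_, σ', hS ▸ .inl ⟨_, hmem, rfl⟩, hx, .inl ⟨⟨_, hmem, rfl⟩, rfl⟩, .inr ⟨rfl, id⟩⟩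
    · cases hmem
      exact ⟨_, σ, hS ▸ .inr rfl, hx, .inr ⟨rfl, rfl⟩, .inr ⟨rfl, id⟩⟩
  | mu Γ y φ hy σ S S₁ hS h₁ c₁ =>
    refine ⟨.mu (Prod.fst '' Γ) y φ hy S.strip S₁.strip
      (by simp [RSeq.strip, hS, Set.image_union, -Set.union_singleton])
      (by simp [RSeq.strip, h₁, Set.image_union, -Set.union_singleton]), rfl, rfl, ?_⟩
    intro a i Δ hi ha φ' σ' x hmem hx
    obtain rfl : S₁ = Δ := by
      simp only [prems, List.getElem?_singleton, Option.ite_none_right_eq_some] at hi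
      exact Option.some.inj hi.2
    have hnu := S₁.mem_nuVars hmem hx
    rw [h₁] at hmem
    rcases hmem with hmem | hmem
    · refine ⟨φ', σ', hS ▸ .inl hmem, hx, .inl ⟨⟨_, hmem, rfl⟩, rfl⟩, .inr ⟨if_neg ?_, id⟩⟩
      rintro ⟨e1, e2, -⟩
      have := Form.eq_var_of_unfoldMu_eq hy (e2.symm.trans e1)
      subst this e1
      simp [Form.nuVars] at hnu
    · cases hmem
      obtain ⟨hsub, heq⟩ := Annot.mem_drop hx
      rw [heq] at hx ⊢
      exact ⟨_, σ, hS ▸ .inr rfl, hx, .inr ⟨rfl, rfl⟩, .inr ⟨if_neg fun h => hsub h.2.2, id⟩⟩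
  | nu Γ y φ hy σ c S S₁ hc hS h₁ c₁ =>
    refine ⟨.nu (Prod.fst '' Γ) y φ hy S.strip S₁.strip
      (by simp [RSeq.strip, hS, Set.image_union, -Set.union_singleton])
      (by simp [RSeq.strip, h₁, Set.image_union, -Set.union_singleton]), rfl, rfl, ?_⟩
    intro a i Δ hi ha φ' σ' x hmem hx
    obtain rfl : S₁ = Δ := by
      simp only [prems, List.getElem?_singleton, Option.ite_none_right_eq_some] at hi
      exact Option.some.inj hi.2
    rw [h₁] at hmem
    rcases hmem with hmem | hmem
    · refine ⟨φ', σ', hS ▸ .inl hmem, hx, .inl ⟨⟨_, hmem, rfl⟩, rfl⟩, ?_⟩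
      -- A context formula that coincides with both the principal formula and its unfolding is
      -- labelled as progress, which is harmless.
      by_cases hl : φ' = Form.nu y φ ∧ φ' = Form.unfoldNu y φ ∧ y = x
      · exact .inl (if_pos hl)
      · exact .inr ⟨if_neg hl, id⟩
    · cases hmem
      have heq := Annot.mem_restrict hx
      rw [heq] at hx ⊢
      -- The appended letter is fresh while `a` is already in the control, so `a` comes from the old
      -- sequence.
      have hac : a ≠ c := fun e => hc (e ▸ ha)
      by_cases hxy : x = y
      · refine ⟨_, σ, hS ▸ .inr rfl, ?_, .inr ⟨rfl, rfl⟩, .inl (if_pos ⟨rfl, rfl, hxy.symm⟩)⟩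
        simpa [Annot.push, hxy, hac] using hx
      · have hp : σ.push y c x = σ x := if_neg hxy
        rw [hp] at hx ⊢
        exact ⟨_, σ, hS ▸ .inr rfl, hx, .inr ⟨rfl, rfl⟩,
          .inr ⟨if_neg fun h => hxy h.2.2.symm, id⟩⟩
  | reset c S S₁ hc hcov h₁ c₁ =>
    obtain ⟨⟨φ, σ⟩, hφ⟩ := hne
    have hmemS : φ ∈ S.strip.forms := ⟨_, hφ, rfl⟩
    refine ⟨.wk (Prod.fst '' S.forms) φ S.strip S₁.strip
      (Set.union_eq_self_of_subset_right (Set.singleton_subset_iff.2 hmemS)).symm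
      (by simp [RSeq.strip, h₁, AForms.reset, Set.image_image]), rfl, rfl, ?_⟩
    intro a i Δ hi ha φ' σ' x hmem hx
    obtain rfl : S₁ = Δ := by
      simp only [prems, List.getElem?_singleton, Option.ite_none_right_eq_some] at hi
      exact Option.some.inj hi.2
    rw [h₁] at hmem
    obtain ⟨⟨ψ, τ⟩, hψ, heq⟩ := hmem
    cases heq
    obtain ⟨h1, h2⟩ := not_last_of_resetList hx
    exact ⟨ψ, τ, hψ, h1, ⟨⟨_, hψ, rfl⟩, rfl⟩,
      .inr ⟨rfl, h2 ((S.sublist _ hψ x).nodup S.nodup)⟩⟩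
  | merge Γ φ σ τ S S₁ hS h₁ c₁ =>
    refine ⟨.wk (Prod.fst '' Γ ∪ {φ}) φ S.strip S₁.strip
      (by simp [RSeq.strip, hS, Set.image_insert_eq])
      (by simp [RSeq.strip, h₁, Set.image_union, -Set.union_singleton]), rfl, rfl, ?_⟩
    intro a i Δ hi ha φ' σ' x hmem hx
    obtain rfl : S₁ = Δ := by
      simp only [prems, List.getElem?_singleton, Option.ite_none_right_eq_some] at hi
      exact Option.some.inj hi.2
    rw [h₁] at hmem
    rcases hmem with hmem | hmem
    · exact ⟨φ', σ', hS ▸ .inl hmem, hx, ⟨.inl ⟨_, hmem, rfl⟩, rfl⟩, .inr ⟨rfl, id⟩⟩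
    · cases hmem
      -- Only this matters about the minimum. Which of the two annotations continues the trace may
      -- depend on `x`.
      have hm : Annot.merge S.ctrl σ τ x = σ x ∨ Annot.merge S.ctrl σ τ x = τ x := by
        unfold Annot.merge ctrlMin
        split_ifs
        · exact .inr rfl
        · exact .inl rfl
      rcases hm with hm | hm
      · rw [hm] at hx ⊢
        exact ⟨φ, σ, hS ▸ .inr (.inl rfl), hx, ⟨.inr rfl, rfl⟩, .inr ⟨rfl, id⟩⟩
      · rw [hm] at hx ⊢
        exact ⟨φ, τ, hS ▸ .inr (.inr rfl), hx, ⟨.inr rfl, rfl⟩, .inr ⟨rfl, id⟩⟩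

theorem RRule.forms_nonempty_or_ctrl_ne_nil {P : Type u} {V : Type v} {C : Type w}
    (r : RRule P V C) : r.concl.forms.Nonempty ∨ r.concl.ctrl ≠ [] := by
  cases r with
  | reset a S S₁ ha => exact .inr (List.ne_nil_of_mem ha)
  | mod Γ φ σ S S₁ hS => exact .inl ⟨(Form.box φ, σ), by simp [concl, hS]⟩
  | _ => left; simp_all [concl]

/-! ### Stripping annotations off a proof -/

section Strip

variable {P : Type u} {V : Type v} {C : Type w} {Q : Preproof (rkDer P V C)}

/-- In a proof, every conclusion of a rule is nonempty: a reset of an empty sequent would have a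
premise with empty control, which is neither a bud nor the conclusion of a rule. -/
theorem concl_nonempty (hQ : Q ∈ (rkMu P V C).proofs) {t : List ℕ} {r : RRule P V C}
    (hr : Q.rule t = some r) : r.concl.forms.Nonempty := by
  cases r with
  | mod Γ φ σ S S₁ hS => exact ⟨(Form.box φ, σ), by simp [RRule.concl, hS]⟩
  | reset a S S₁ ha hcov h₁ c₁ =>
    rw [Set.nonempty_iff_ne_empty]
    intro hemp
    change S.forms = ∅ at hemp
    have hf : S₁.forms = ∅ := by simp [h₁, hemp, AForms.reset]
    have hctrl : S₁.ctrl = [] := by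
      rw [c₁, hf]
      simp [AForms.prune, AForms.Occurs]
    have hlab : Q.lab (t ++ [0]) = S₁ := Q.rule_prems t _ hr 0 S₁ rfl
    have hmem : t ++ [0] ∈ Q.nodes := by
      have : t ++ [0] ∈ Q.children t := by
        rw [Q.rule_children t _ hr]
        exact ⟨0, Nat.one_pos, rfl⟩
      exact this.1
    cases hb : Q.back (t ++ [0]) with
    | some c =>
      obtain ⟨a', l, h1, -⟩ := hQ.2 _ _ hb
      obtain ⟨r', hr'⟩ := h1 _ (Q.back_lt _ _ hb).1 List.prefix_rfl
      rw [hlab, hctrl] at hr'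
      simp at hr'
    | none =>
      cases hρ : Q.rule (t ++ [0]) with
      | none => exact hQ.1 _ ⟨Q.leaf_of_no_rule _ hmem hb hρ, hb, hρ⟩
      | some ρ =>
        have hcon : ρ.concl = S₁ := (Q.rule_concl _ _ hρ).trans hlab
        rcases ρ.forms_nonempty_or_ctrl_ne_nil with h | h
        · rw [hcon, hf] at h
          exact Set.not_nonempty_empty h
        · exact h (by rw [hcon, hctrl])
  | _ => simp_all [RRule.concl]

/-- The un-annotated preproof. -/
theorem exists_strip (hQ : Q ∈ (rkMu P V C).proofs) :
    ∃ K : Preproof (kDer P V), K.toCyclicTree = Q.toCyclicTree ∧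
      (∀ t, K.lab t = RSeq.strip (Q.lab t)) ∧ K.NoAssumptions ∧
      ∀ (t : List ℕ) (r : RRule P V C), Q.rule t = some r →
        ∃ k : KRule P V, K.rule t = some k ∧ r.TracesBack k := by
  -- Stated with options so that one choice of rules covers all words, including those without a
  -- rule.
  have hex : ∀ t, ∃ o : Option (KRule P V), (Q.rule t = none → o = none) ∧
      ∀ r, Q.rule t = some r → ∃ k : KRule P V, o = some k ∧ k.concl = r.concl.strip ∧
        k.prems = r.prems.map RSeq.strip ∧ r.TracesBack k := by
    intro t
    cases hr : Q.rule t with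
    | none => exact ⟨none, fun _ => rfl, by simp⟩
    | some r =>
      obtain ⟨k, hk⟩ := r.exists_tracesBack (concl_nonempty hQ hr)
      refine ⟨some k, by simp, fun r' hr' => ?_⟩
      cases hr'
      exact ⟨k, rfl, hk⟩
  choose f hf₀ hf using hex
  have hf' : ∀ t k, f t = some k → ∃ r, Q.rule t = some r ∧ k.concl = r.concl.strip ∧
      k.prems = r.prems.map RSeq.strip := by
    intro t k hk
    cases hr : Q.rule t with
    | none => rw [hf₀ t hr] at hk; cases hk
    | some r =>
      obtain ⟨k', h1, h2, h3, -⟩ := hf t r hr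
      rw [hk] at h1
      cases h1
      exact ⟨r, rfl, h2, h3⟩
  have hnone : ∀ t, f t = none → Q.rule t = none := by
    intro t ht
    cases hr : Q.rule t with
    | none => rfl
    | some r =>
      obtain ⟨k', h1, -⟩ := hf t r hr
      rw [ht] at h1
      cases h1
  refine ⟨{ toCyclicTree := Q.toCyclicTree
            lab := fun t => RSeq.strip (Q.lab t)
            lab_back := fun t c h => by rw [Q.lab_back t c h]
            rule := f
            rule_mem := fun t k hk => ?_
            rule_not_bud := fun t k hk => ?_
            rule_concl := fun t k hk => ?_
            rule_children := fun t k hk => ?_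
            rule_prems := fun t k hk i Δ hi => ?_
            leaf_of_no_rule := fun t h1 h2 h3 => Q.leaf_of_no_rule t h1 h2 (hnone t h3) },
    rfl, fun _ => rfl, fun t ht => hQ.1 t ⟨ht.1, ht.2.1, hnone t ht.2.2⟩, fun t r hr => ?_⟩
  · obtain ⟨r, hr, -⟩ := hf' t k hk
    exact Q.rule_mem t r hr
  · obtain ⟨r, hr, -⟩ := hf' t k hk
    exact Q.rule_not_bud t r hr
  · obtain ⟨r, hr, hc, -⟩ := hf' t k hk
    have := Q.rule_concl t r hr
    exact hc.trans (congrArg RSeq.strip this)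
  · obtain ⟨r, hr, -, hp⟩ := hf' t k hk
    have := Q.rule_children t r hr
    have hlen : k.prems.length = r.prems.length := by simp [hp]
    change Q.children t = {s | ∃ i : ℕ, i < k.prems.length ∧ s = t ++ [i]}
    rw [hlen]
    exact this
  · obtain ⟨r, hr, -, hp⟩ := hf' t k hk
    change k.prems[i]? = some Δ at hi
    rw [hp, List.getElem?_map, Option.map_eq_some_iff] at hi
    obtain ⟨S, hS, rfl⟩ := hi
    exact congrArg RSeq.strip (Q.rule_prems t r hr i S hS)
  · obtain ⟨k, h1, -, -, h4⟩ := hf t r hr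
    exact ⟨k, h1, h4⟩

end Strip

/-! ### Traces -/

theorem rel_eqToHom {P : Type u} {V : Type v} {Γ Δ : KSeq P V} (h : Γ = Δ)
    (p : Γ.TracePoint) (q : Δ.TracePoint) (hpq : p.1 = q.1) :
    ((p, 0, q) : Γ.TracePoint × Fin 3 × Δ.TracePoint) ∈
      TraceCat.rel (eqToHom (congrArg (failureTrace P V).obj h)) := by
  subst h
  rw [eqToHom_refl]
  exact ⟨Subtype.ext hpq, rfl⟩

/-- Inverse sequences of nonempty finite types have compatible families of points. -/
theorem exists_compatible_of_finite (L : ℕ → Type u) [∀ n, Finite (L n)] [∀ n, Nonempty (L n)]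
    (f : ∀ n, L (n + 1) → L n) : ∃ s : ∀ n, L n, ∀ n, f n (s (n + 1)) = s n := by
  let F : ℕᵒᵖ ⥤ Type u := Functor.ofOpSequence (X := L) (fun n => ↾(f n))
  have : ∀ j, Finite (F.obj j) := fun j => inferInstanceAs (Finite (L j.unop))
  have : ∀ j, Nonempty (F.obj j) := fun j => inferInstanceAs (Nonempty (L j.unop))
  -- König's lemma, as nonemptiness of a cofiltered limit of finite nonempty types.
  obtain ⟨s, hs⟩ := nonempty_sections_of_finite_cofiltered_system F
  refine ⟨fun n => s (Opposite.op n), fun n => ?_⟩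
  have := hs (homOfLE (Nat.le_add_right n 1)).op
  rw [Functor.ofOpSequence_map_homOfLE_succ] at this
  exact this

theorem Preproof.IsBranch.step_cases {D : DerivationSystem.{u, v}} {Q : Preproof D}
    {b : ℕ → List ℕ} (h : Q.IsBranch b) (i : ℕ) :
    Q.back (b i) = some (b (i + 1)) ∨ ∃ (r : D.Rule) (j : ℕ), Q.rule (b i) = some r ∧
      b (i + 1) = b i ++ [j] ∧ (D.prems r)[j]? = some (Q.lab (b (i + 1))) := by
  rcases h.step i with hb | ⟨hl, j, hj⟩
  · exact .inl hb
  · right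
    cases hr : Q.rule (b i) with
    | none =>
      cases hb : Q.back (b i) with
      | none => exact absurd (Q.leaf_of_no_rule _ (h.mem_nodes i) hb hr) hl
      | some c => exact absurd (Q.back_leaf _ _ hb) hl
    | some r =>
      have hmem := h.inner i hl
      rw [Q.rule_children _ _ hr] at hmem
      obtain ⟨m, hm, hbm⟩ := hmem
      refine ⟨r, m, rfl, hbm, ?_⟩
      rw [hbm, Q.rule_prems _ _ hr m _ (List.getElem?_eq_getElem hm), List.getElem?_eq_getElem hm]

/-! ### Backward traces for a stable letter -/

section Branch

variable {P : Type u} {V : Type v} {C : Type w} {Q : Preproof (rkDer P V C)}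
  {K : Preproof (kDer P V)} {b : ℕ → List ℕ}

theorem exists_trace_step (hK : K.toCyclicTree = Q.toCyclicTree)
    (hlab : ∀ t, K.lab t = RSeq.strip (Q.lab t))
    (hrule : ∀ (t : List ℕ) (r : RRule P V C), Q.rule t = some r →
      ∃ k : KRule P V, K.rule t = some k ∧ r.TracesBack k)
    (hQ : Q.IsBranch b) (hb : K.IsBranch b) {a : C} {i : ℕ}
    (ha : a ∈ RSeq.ctrl (Q.lab (b i))) (q : KSeq.TracePoint (K.lab (b (i + 1))))
    {σ' : Annot V C} (hq : (q.1.1, σ') ∈ RSeq.forms (Q.lab (b (i + 1)))) (hqa : a ∈ σ' q.1.2) :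
    ∃ (p : KSeq.TracePoint (K.lab (b i))) (σ : Annot V C) (c : Fin 3),
      (p.1.1, σ) ∈ RSeq.forms (Q.lab (b i)) ∧ a ∈ σ p.1.2 ∧
      (p, c, q) ∈ TraceCat.rel ((failureTrace P V).stepHom K (b i) (b (i + 1))) ∧
      (c = 1 ∨ c = 0 ∧ ((σ' q.1.2).getLast? ≠ some a → (σ p.1.2).getLast? ≠ some a)) := by
  rcases hQ.step_cases i with hback | ⟨r, j, hr, hj, hΔ⟩
  · have hback' : K.back (b i) = some (b (i + 1)) := by rw [hK]; exact hback
    have hl := K.lab_back _ _ hback'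
    have hl' := Q.lab_back _ _ hback
    refine ⟨⟨q.1, by rw [hl]; exact q.2⟩, σ', 0, by rw [hl']; exact hq, hqa, .inr ⟨hback', ?_⟩, .inr ⟨rfl, id⟩⟩
    exact rel_eqToHom hl _ _ rfl
  · obtain ⟨k, hk, htr⟩ := hrule _ _ hr
    rw [← Q.rule_concl _ _ hr] at ha
    obtain ⟨φ, σ, hφ, haσ, hprec, hlabel⟩ := htr a j _ hΔ ha q.1.1 σ' q.1.2 hq hqa
    have hφ' : (φ, σ) ∈ RSeq.forms (Q.lab (b i)) := by
      rw [← Q.rule_concl _ _ hr]; exact hφ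
    refine ⟨⟨(φ, q.1.2), ?_, RSeq.mem_nuVars _ hφ' haσ⟩, σ, k.label φ q.1.1 q.1.2, hφ', haσ,
      .inl ⟨k, j, K.rule_concl _ _ hk, ?_, hk, hj, rfl, hprec, rfl⟩, hlabel⟩
    · rw [hlab]
      exact ⟨_, hφ', rfl⟩
    · rcases hb.step_cases i with h | ⟨k', j', hk', hj', h⟩
      · rw [K.rule_not_bud _ _ hk] at h
        cases h
      · rw [hk] at hk'
        cases hk'
        rw [hj, List.append_cancel_left_eq, List.singleton_inj] at hj'
        rw [hj']
        exact h

theorem exists_trace (hK : K.toCyclicTree = Q.toCyclicTree)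
    (hlab : ∀ t, K.lab t = RSeq.strip (Q.lab t))
    (hrule : ∀ (t : List ℕ) (r : RRule P V C), Q.rule t = some r →
      ∃ k : KRule P V, K.rule t = some k ∧ r.TracesBack k)
    (hQ : Q.IsBranch b) (hb : K.IsBranch b) {a : C} {i j : ℕ} (hij : i ≤ j)
    (ha : ∀ m, i ≤ m → a ∈ RSeq.ctrl (Q.lab (b m)))
    (q : KSeq.TracePoint (K.lab (b j))) {σ' : Annot V C}
    (hq : (q.1.1, σ') ∈ RSeq.forms (Q.lab (b j))) (hqa : a ∈ σ' q.1.2) :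
    ∃ (p : KSeq.TracePoint (K.lab (b i))) (σ : Annot V C) (c : Fin 3),
      (p.1.1, σ) ∈ RSeq.forms (Q.lab (b i)) ∧ a ∈ σ p.1.2 ∧
      (p, c, q) ∈ TraceCat.rel (((failureTrace P V).branchPath K b).map (homOfLE hij)) ∧
      (c = 1 ∨ c = 0 ∧ ((σ' q.1.2).getLast? ≠ some a → (σ p.1.2).getLast? ≠ some a)) := by
  induction j, hij using Nat.le_induction generalizing σ' with
  | base =>
    refine ⟨q, σ', 0, hq, hqa, ?_, .inr ⟨rfl, id⟩⟩
    have hid : ((failureTrace P V).branchPath K b).map (homOfLE (le_refl i)) = 𝟙 _ :=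
      CategoryTheory.Functor.map_id _ i
    exact (Set.ext_iff.1 (congrArg TraceCat.rel hid) (q, 0, q)).2 ⟨rfl, rfl⟩
  | succ j hij ih =>
    obtain ⟨p₁, σ₁, c₁, h1, h2, h3, h4⟩ :=
      exists_trace_step hK hlab hrule hQ hb (ha j hij) q hq hqa
    obtain ⟨p, σ, c, g1, g2, g3, g4⟩ := ih p₁ h1 h2
    refine ⟨p, σ, c ⊔ c₁, g1, g2, ?_, ?_⟩
    · rw [← homOfLE_comp hij (Nat.le_add_right j 1), Functor.map_comp]
      refine ⟨p₁, c, c₁, g3, ?_, rfl⟩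
      have : ((failureTrace P V).branchPath K b).map (homOfLE (Nat.le_add_right j 1)) =
          (failureTrace P V).stepHom K (b j) (b (j + 1)) :=
        Functor.ofSequence_map_homOfLE_succ _ _
      rw [this]
      exact h3
    -- With labels 0 and 1 only, the join is 1 unless both are 0; then the two implications about
    -- last letters compose.
    · rcases h4 with rfl | ⟨rfl, h4⟩ <;> rcases g4 with rfl | ⟨rfl, g4⟩
      · exact .inl rfl
      · exact .inl rfl
      · exact .inl rfl
      · exact .inr ⟨rfl, g4 ∘ h4⟩

/-- The first two facts conflict along a trace without progress from one reset to the next. The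
third makes the levels of the König argument nonempty; it holds since the premise's control is
pruned to occurring letters. -/
theorem reset_step (hQ : Q.IsBranch b) {a : C} {i : ℕ} {ρ : RRule P V C}
    (hρ : Q.rule (b i) = some ρ) (ha : ρ.IsReset a) :
    (RSeq.forms (Q.lab (b i))).Covered a ∧
      (∀ φ σ x, (φ, σ) ∈ RSeq.forms (Q.lab (b (i + 1))) → a ∈ σ x →
        (σ x).getLast? = some a) ∧
      (a ∈ RSeq.ctrl (Q.lab (b (i + 1))) → (RSeq.forms (Q.lab (b (i + 1)))).Occurs a) := by
  classical
  cases ρ with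
  | reset c S S₁ hc hcov h₁ c₁ =>
    obtain rfl : c = a := ha
    have hcon : S = Q.lab (b i) := Q.rule_concl _ _ hρ
    rcases hQ.step_cases i with h | ⟨r, j, hr, hj, hΔ⟩
    · rw [Q.rule_not_bud _ _ hρ] at h
      cases h
    · rw [hρ] at hr
      cases hr
      have hlab : S₁ = Q.lab (b (i + 1)) := by
        simp only [RRule.prems, List.getElem?_singleton, Option.ite_none_right_eq_some] at hΔ
        exact Option.some.inj hΔ.2
      rw [← hcon, ← hlab]
      refine ⟨hcov, fun φ σ x hmem hx => ?_, fun hmem => ?_⟩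
      · rw [h₁] at hmem
        obtain ⟨⟨ψ, τ⟩, hψ, heq⟩ := hmem
        cases heq
        exact getLast?_resetList hx
      · rw [c₁] at hmem
        simpa using (List.mem_filter.1 hmem).2
  | _ => exact ha.elim

theorem traceCondition_of_strip (hinv : ∀ t c, Q.back t = some c → HasInvariant Q c t)
    (hK : K.toCyclicTree = Q.toCyclicTree) (hlab : ∀ t, K.lab t = RSeq.strip (Q.lab t))
    (hrule : ∀ (t : List ℕ) (r : RRule P V C), Q.rule t = some r →
      ∃ k : KRule P V, K.rule t = some k ∧ r.TracesBack k)
    (hb : K.IsBranch b) :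
    TraceCat.TraceCondition ((failureTrace P V).branchPath K b) := by
  have hQ : Q.IsBranch b := ⟨hb.zero, hK ▸ hb.inner, hK ▸ hb.leaf⟩
  obtain ⟨a, N, hctrl, hreset⟩ := exists_stable_letter hinv hQ
  obtain ⟨r, hr, hρ⟩ := Nat.exists_strictMono_subsequence
    (P := fun m => N ≤ m ∧ ∃ ρ : RRule P V C, Q.rule (b m) = some ρ ∧ ρ.IsReset a) (fun n => by
      obtain ⟨i, hi, h⟩ := hreset (max (n + 1) N)
      exact ⟨i, by omega, by omega, h⟩)
  -- Levels sit at the premise of each reset, hence `r n + 1`: there `a` is last wherever it occurs.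
  let L (n : ℕ) : Type (max u v) := {p : KSeq.TracePoint (K.lab (b (r n + 1))) //
    ∃ σ : Annot V C, (p.1.1, σ) ∈ RSeq.forms (Q.lab (b (r n + 1))) ∧ a ∈ σ p.1.2}
  have : ∀ n, Finite (L n) := fun n =>
    have := KSeq.finite_tracePoint (K.lab (b (r n + 1)))
    Subtype.finite
  have : ∀ n, Nonempty (L n) := fun n => by
    obtain ⟨hN, ρ, h1, h2⟩ := hρ n
    obtain ⟨⟨φ, σ⟩, hφ, x, hx, hax⟩ := (reset_step hQ h1 h2).2.2 (hctrl _ (by omega))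
    exact ⟨⟨⟨(φ, x), by rw [hlab]; exact ⟨_, hφ, rfl⟩, hx⟩, σ, hφ, hax⟩⟩
  have hS : StrictMono fun n => r n + 1 := fun m n h => Nat.succ_lt_succ (hr h)
  have hpred : ∀ n (q : L (n + 1)), ∃ p : L n, (p.1, (1 : Fin 3), q.1) ∈
      TraceCat.rel (((failureTrace P V).branchPath K b).map
        (homOfLE (hS.monotone (Nat.le_succ n)))) := by
    rintro n ⟨q, σ', hq, hqa⟩
    have hlt : r n + 1 ≤ r (n + 1) := hr (Nat.lt_succ_self n)
    have hctrl' : ∀ m, r n + 1 ≤ m → a ∈ RSeq.ctrl (Q.lab (b m)) := fun m hm =>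
      hctrl m (by have := (hρ n).1; omega)
    obtain ⟨-, ρ, h1, h2⟩ := hρ (n + 1)
    obtain ⟨-, ρ', h1', h2'⟩ := hρ n
    obtain ⟨p₁, σ₁, c₁, e1, e2, e3, e4⟩ :=
      exists_trace_step hK hlab hrule hQ hb (hctrl' _ hlt) q hq hqa
    obtain ⟨p, σ, c, g1, g2, g3, g4⟩ :=
      exists_trace hK hlab hrule hQ hb hlt hctrl' p₁ e1 e2
    have hcov := (reset_step hQ h1 h2).1 _ e1 p₁.1.2 p₁.2.2 e2
    have hlast := (reset_step hQ h1' h2').2.1 _ _ _ g1 g2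
    -- With label 0, `a` being covered before reset `n + 1` would make it not last after reset `n`.
    have hc : c = 1 := g4.resolve_right fun h => h.2 hcov hlast
    refine ⟨⟨p, σ, g1, g2⟩, ?_⟩
    rw [← homOfLE_comp hlt (Nat.le_add_right _ 1), Functor.map_comp]
    refine ⟨p₁, c, c₁, g3, ?_, ?_⟩
    · have : ((failureTrace P V).branchPath K b).map
          (homOfLE (Nat.le_add_right (r (n + 1)) 1)) =
          (failureTrace P V).stepHom K (b (r (n + 1))) (b (r (n + 1) + 1)) :=
        Functor.ofSequence_map_homOfLE_succ _ _
      rw [this]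
      exact e3
    · rw [hc]
      -- The closing reset step has label 0 or 1, so the join stays 1.
      rcases e4 with rfl | ⟨rfl, -⟩ <;> rfl
  choose f hf using hpred
  obtain ⟨s, hs⟩ := exists_compatible_of_finite L f
  refine ⟨fun n => r n + 1, hS, fun n => (s n).1, fun n => ?_⟩
  have := hf n (s (n + 1))
  rw [hs n] at this
  exact this

end Branch

/-! ### Soundness -/

theorem kMu_proves_strip {P : Type u} {V : Type v} {C : Type w} {S : RSeq P V C}
    (h : (rkMu P V C).Proves S) : (kMu P V).Proves S.strip := by
  obtain ⟨Q, hQ, rfl⟩ := h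
  obtain ⟨K, hK, hlab, hopen, hrule⟩ := exists_strip hQ
  exact ⟨K, ⟨hopen, fun b hb => traceCondition_of_strip hQ.2 hK hlab hrule hb⟩, hlab []⟩

theorem KSeq.strip_annotate {P : Type u} {V : Type v} (Γ : KSeq P V) (C : Type w) :
    (Γ.annotate C).strip = Γ :=
  KSeq.ext_forms (by simp [RSeq.strip, KSeq.annotate, Set.image_image])

end CyclicMu

theorem mainTheorem9 (P : Type*) (V : Type*) (C : Type*) :
    (∀ S : CyclicMu.RSeq P V C,
      (CyclicMu.rkMu P V C).Proves S → (CyclicMu.kMu P V).Proves S.strip) ∧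
    (∀ Γ : CyclicMu.KSeq P V,
      CyclicMu.rkProves P V C Γ → (CyclicMu.kMu P V).Proves Γ) :=
  ⟨fun _ => CyclicMu.kMu_proves_strip, fun Γ h =>
    Γ.strip_annotate C ▸ CyclicMu.kMu_proves_strip h⟩
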